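/- Let $(M^m,g)$ and $(N^n,h=\langle\cdot,\cdot\rangle)$ be smooth Riemannian manifolds without boundary, and suppose that $N$ has non-positive sectional curvature. Let $\phi:M\to N$ be a smooth isometric immersion, i.e. $\langle d\phi(X),d\phi(Y)\rangle=g(X,Y)$ for all tangent vectors $X,Y$ of $M$ at the same point. Let $\nabla$ and $\nabla^N$ be the Levi-Civita connections of $M$ and $N$, $\nabla^\phi$ the connection on $\phi^{-1}TN$ induced by $\nabla^N$, $B(X,Y)=\nabla^\phi_X(d\phi(Y))-d\phi(\nabla_XY)$ the second fundamental form, and $${\bf H}=\frac1m\sum_{i=1}^m B(e_i,e_i)$$ the mean curvature vector field, where $\{e_i\}_{i=1}^m$ is a local orthonormal frame on $M$ (if $m=0$, ${\bf H}=0$). Write $\Delta^\phi=\sum_{i=1}^m(\nabla^\phi_{e_i}\nabla^\phi_{e_i}-\nabla^\phi_{\nabla_{e_i}e_i})$, $\Delta=\sum_{i=1}^m(e_ie_i-\nabla_{e_i}e_i)$ for the (non-positive) Laplace operator on functions on $M$, $R^N(X,Y)Z=[\nabla^N_X,\nabla^N_Y]Z-\nabla^N_{[X,Y]}Z$, and $[\,\cdot\,]^\perp$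 for the component orthogonal to $d\phi(TM)$. Suppose that $M$ is a non-negative biminimal submanifold of $N$, that is, for some real constant $\lambda\ge 0$, $$\Big[-\Delta^\phi{\bf H}-\sum_{i=1}^m R^N({\bf H},d\phi(e_i))d\phi(e_i)\Big]^\perp+\lambda{\bf H}=0\quad\text{on } M.$$ Then, at every point of $M$, $$\Delta|{\bf H}|^2\ \ge\ 2m\,|{\bf H}|^4 .$$ -/

import Mathlib

open Bundle
open scoped Manifold ContDiff

namespace RiemGeom

noncomputable section

/-! ## Riemannian geometry in a coordinate domain

A metric in coordinates is a map `g : E → E →L[ℝ] E →L[ℝ] ℝ`; the vectors `v w : E` are also used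
as constant vector fields (the coordinate fields and their linear combinations). -/

section Coordinates

variable {E F : Type*} [NormedAddCommGroup E] [NormedSpace ℝ E]
  [NormedAddCommGroup F] [NormedSpace ℝ F]

/-- The linear form `z ↦ (1/2) (∂_v g(w, z) + ∂_w g(v, z) - ∂_z g(v, w))` at the point `u`. -/
def koszulForm (g : E → E →L[ℝ] E →L[ℝ] ℝ) (u v w : E) : E →L[ℝ] ℝ :=
  (1 / 2 : ℝ) • (fderiv ℝ g u v w + fderiv ℝ g u w v - ((fderiv ℝ g u).flip v).flip w)

/-- The Christoffel symbol `Γ_u(v, w) = ∇_v w` of the Levi-Civita connection of `g`, that is, the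
vector with `g_u(Γ_u(v, w), z) = (1/2) (∂_v g(w, z) + ∂_w g(v, z) - ∂_z g(v, w))` for all `z`. -/
def christoffel (g : E → E →L[ℝ] E →L[ℝ] ℝ) (u v w : E) : E :=
  (g u).inverse (koszulForm g u v w)

/-- The Riemannian curvature `R(X, Y) Z = ∇_X ∇_Y Z - ∇_Y ∇_X Z - ∇_[X, Y] Z` of `g` at `u`,
computed with constant vector fields `X Y Z`. -/
def coordCurvature (g : E → E →L[ℝ] E →L[ℝ] ℝ) (u X Y Z : E) : E :=
  (fderiv ℝ (fun u' => christoffel g u' Y Z) u X + christoffel g u X (christoffel g u Y Z))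
    - (fderiv ℝ (fun u' => christoffel g u' X Z) u Y + christoffel g u Y (christoffel g u X Z))

/-- The covariant derivative `∇^f_v V` at `u` of a vector field `V` along the map `f : E → F`, for
the pull-back by `f` of the Levi-Civita connection of the metric `h` on the target. -/
def covAlong (h : F → F →L[ℝ] F →L[ℝ] ℝ) (f : E → F) (V : E → F) (u v : E) : F :=
  fderiv ℝ V u v + christoffel h (f u) (fderiv ℝ f u v) (V u)

/-- `∇^f_v (df(w)) - df(∇_v w)` at `u`, where `∇` is the Levi-Civita connection of `g`. -/
def coordSecondForm (g : E → E →L[ℝ] E →L[ℝ] ℝ) (h : F → F →L[ℝ] F →L[ℝ] ℝ) (f : E → F)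
    (u v w : E) : F :=
  covAlong h f (fun u' => fderiv ℝ f u' w) u v - fderiv ℝ f u (christoffel g u v w)

/-- The second covariant derivative `∇^f_v ∇^f_w V - ∇^f_(∇_v w) V` at `u` of a vector field `V`
along `f`. -/
def coordHessAlong (g : E → E →L[ℝ] E →L[ℝ] ℝ) (h : F → F →L[ℝ] F →L[ℝ] ℝ) (f : E → F)
    (V : E → F) (u v w : E) : F :=
  covAlong h f (fun u' => covAlong h f V u' w) u v - covAlong h f V u (christoffel g u v w)

/-- The Hessian `v(w(a)) - (∇_v w)(a)` at `u` of a real function `a`. -/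
def coordHess (g : E → E →L[ℝ] E →L[ℝ] ℝ) (a : E → ℝ) (u v w : E) : ℝ :=
  fderiv ℝ (fun u' => fderiv ℝ a u' w) u v - fderiv ℝ a u (christoffel g u v w)

end Coordinates

/-! ## Riemannian manifolds

`M` is a manifold without boundary modelled on `E`, with an inner product on each tangent space. -/

section Manifold

variable {E : Type*} [NormedAddCommGroup E] [NormedSpace ℝ E]
  {M : Type*} [TopologicalSpace M] [ChartedSpace E M] [IsManifold 𝓘(ℝ, E) ∞ M]

/-- The coordinates of tangent vectors at `y` in the chart around `x₀` (the differential at `y` of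
that chart, for `y` in its domain). -/
def toCoord (x₀ y : M) : TangentSpace 𝓘(ℝ, E) y →L[ℝ] E :=
  (trivializationAt E (TangentSpace 𝓘(ℝ, E)) x₀).continuousLinearMapAt ℝ y

/-- The tangent vectors at `y` with given coordinates in the chart around `x₀`: the inverse of
`toCoord x₀ y`, for `y` in the domain of that chart. -/
def ofCoord (x₀ y : M) : E →L[ℝ] TangentSpace 𝓘(ℝ, E) y :=
  (trivializationAt E (TangentSpace 𝓘(ℝ, E)) x₀).symmL ℝ y

variable [RiemannianBundle (fun x : M => TangentSpace 𝓘(ℝ, E) x)]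

/-- The Riemannian metric of `M` in the coordinates of the chart around `x₀`. -/
def coordMetric (x₀ : M) (u : E) : E →L[ℝ] E →L[ℝ] ℝ :=
  (innerSL ℝ).bilinearComp
    (ofCoord x₀ ((extChartAt 𝓘(ℝ, E) x₀).symm u)) (ofCoord x₀ ((extChartAt 𝓘(ℝ, E) x₀).symm u))

/-- The Riemannian curvature `R(X, Y) Z` of `M` at `x`, with the sign convention
`R(X, Y) Z = [∇_X, ∇_Y] Z - ∇_[X, Y] Z`. -/
def curvature (x : M) (X Y Z : TangentSpace 𝓘(ℝ, E) x) : TangentSpace 𝓘(ℝ, E) x :=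
  ofCoord x x (coordCurvature (coordMetric x) (extChartAt 𝓘(ℝ, E) x x)
    (toCoord x x X) (toCoord x x Y) (toCoord x x Z))

/-- The sectional curvature of the plane spanned by `X` and `Y` (meaningful if `X` and `Y` are
linearly independent). -/
def sectionalCurvature (x : M) (X Y : TangentSpace 𝓘(ℝ, E) x) : ℝ :=
  inner ℝ (curvature x X Y Y) X / (‖X‖ ^ 2 * ‖Y‖ ^ 2 - inner ℝ X Y ^ 2)

variable (E M) in
/-- All sectional curvatures of `M` are at most `0`. -/
def NonposSectionalCurvature : Prop :=
  ∀ (x : M) (X Y : TangentSpace 𝓘(ℝ, E) x), LinearIndependent ℝ ![X, Y] →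
    sectionalCurvature x X Y ≤ 0

variable [FiniteDimensional ℝ E]

instance finiteDimensional_tangentSpace (x : M) :
    FiniteDimensional ℝ (TangentSpace 𝓘(ℝ, E) x) :=
  inferInstanceAs (FiniteDimensional ℝ E)

/-- The metric trace `∑ i, β(e_i, e_i)`, where `(e_i)` is an orthonormal basis of the tangent space
at `x`; for bilinear `β` it does not depend on the basis. -/
def metricTrace {W : Type*} [AddCommGroup W] (x : M)
    (β : TangentSpace 𝓘(ℝ, E) x → TangentSpace 𝓘(ℝ, E) x → W) : W :=
  ∑ i, β (stdOrthonormalBasis ℝ (TangentSpace 𝓘(ℝ, E) x) i)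
    (stdOrthonormalBasis ℝ (TangentSpace 𝓘(ℝ, E) x) i)

variable (E) in
/-- The Laplace-Beltrami operator `Δ a = ∑ i, (e_i(e_i(a)) - (∇_(e_i) e_i)(a))`. -/
def laplacian (a : M → ℝ) (x : M) : ℝ :=
  metricTrace x fun v w =>
    coordHess (coordMetric x) (a ∘ (extChartAt 𝓘(ℝ, E) x).symm) (extChartAt 𝓘(ℝ, E) x x)
      (toCoord x x v) (toCoord x x w)

end Manifold

/-! ## Maps between Riemannian manifolds -/

section Maps

variable {E : Type*} [NormedAddCommGroup E] [NormedSpace ℝ E] [FiniteDimensional ℝ E]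
  {M : Type*} [TopologicalSpace M] [ChartedSpace E M] [IsManifold 𝓘(ℝ, E) ∞ M]
  [RiemannianBundle (fun x : M => TangentSpace 𝓘(ℝ, E) x)]
  {F : Type*} [NormedAddCommGroup F] [NormedSpace ℝ F] [FiniteDimensional ℝ F]
  {N : Type*} [TopologicalSpace N] [ChartedSpace F N] [IsManifold 𝓘(ℝ, F) ∞ N]
  [RiemannianBundle (fun y : N => TangentSpace 𝓘(ℝ, F) y)]

variable (E F) in
/-- `φ` is a (smooth) isometric immersion: its differential preserves inner products. -/
structure IsIsometricImmersion (φ : M → N) : Prop where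
  contMDiff : ContMDiff 𝓘(ℝ, E) 𝓘(ℝ, F) ∞ φ
  inner_mfderiv : ∀ (x : M) (v w : TangentSpace 𝓘(ℝ, E) x),
    inner ℝ (mfderiv 𝓘(ℝ, E) 𝓘(ℝ, F) φ x v) (mfderiv 𝓘(ℝ, E) 𝓘(ℝ, F) φ x w) = inner ℝ v w

/-- The map `φ` in the charts around `x` and `φ x`. -/
def coordMap (φ : M → N) (x : M) : E → F :=
  extChartAt 𝓘(ℝ, F) (φ x) ∘ φ ∘ (extChartAt 𝓘(ℝ, E) x).symm

/-- The vector field `V` along `φ` in the charts around `x` and `φ x`. -/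
def coordField (φ : M → N) (V : ∀ y : M, TangentSpace 𝓘(ℝ, F) (φ y)) (x : M) (u : E) : F :=
  toCoord (φ x) (φ ((extChartAt 𝓘(ℝ, E) x).symm u)) (V ((extChartAt 𝓘(ℝ, E) x).symm u))

variable (E F) in
/-- The second fundamental form given by the Gauss formula:
`B(X, Y) = ∇^N_X Y - ∇_X Y`, that is, `∇^φ_X (dφ(Y)) - dφ(∇_X Y)`. -/
def secondFundamentalForm (φ : M → N) (x : M) (v w : TangentSpace 𝓘(ℝ, E) x) :
    TangentSpace 𝓘(ℝ, F) (φ x) :=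
  ofCoord (φ x) (φ x) (coordSecondForm (coordMetric x) (coordMetric (φ x)) (coordMap φ x)
    (extChartAt 𝓘(ℝ, E) x x) (toCoord x x v) (toCoord x x w))

variable (E F) in
/-- The mean curvature vector field `H = (1/m) ∑ i, B(e_i, e_i)`, where `m = dim M`. -/
def meanCurvature (φ : M → N) (x : M) : TangentSpace 𝓘(ℝ, F) (φ x) :=
  (Module.finrank ℝ E : ℝ)⁻¹ • metricTrace x (secondFundamentalForm E F φ x)

variable (E) in
/-- The rough Laplacian `Δ^φ V = ∑ i, (∇^φ_(e_i) ∇^φ_(e_i) V - ∇^φ_(∇_(e_i) e_i) V)` of a vector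
field `V` along `φ`. -/
def roughLaplacian (φ : M → N) (V : ∀ y : M, TangentSpace 𝓘(ℝ, F) (φ y)) (x : M) :
    TangentSpace 𝓘(ℝ, F) (φ x) :=
  metricTrace x fun v w =>
    ofCoord (φ x) (φ x) (coordHessAlong (coordMetric x) (coordMetric (φ x)) (coordMap φ x)
      (coordField φ V x) (extChartAt 𝓘(ℝ, E) x x) (toCoord x x v) (toCoord x x w))

variable (E) in
/-- The component of `W` orthogonal to the image of the differential of `φ`. -/
def normalPart (φ : M → N) (x : M) (W : TangentSpace 𝓘(ℝ, F) (φ x)) :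
    TangentSpace 𝓘(ℝ, F) (φ x) :=
  W - (LinearMap.range (mfderiv 𝓘(ℝ, E) 𝓘(ℝ, F) φ x).toLinearMap).starProjection W

variable (E F) in
/-- The isometric immersion `φ` makes `M` a biminimal submanifold with constant `lam`:
`[-Δ^φ H - ∑ i, R^N(H, dφ(e_i)) dφ(e_i)]^⊥ + lam H = 0` at every point. -/
structure IsBiminimalSubmanifold (φ : M → N) (lam : ℝ) : Prop where
  isometric : IsIsometricImmersion E F φ
  equation : ∀ x : M,
    normalPart E φ x (-roughLaplacian E φ (meanCurvature E F φ) x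
      - metricTrace x (fun v w => curvature (φ x) (meanCurvature E F φ x)
          (mfderiv 𝓘(ℝ, E) 𝓘(ℝ, F) φ x v) (mfderiv 𝓘(ℝ, E) 𝓘(ℝ, F) φ x w)))
      + lam • meanCurvature E F φ x = 0

end Maps

end

end RiemGeom

/-! The Bochner formula gives (1/2) Δ|H|² = ⟨Δ^φ H, H⟩ + |∇^φ H|², and the two terms are bounded
separately.

Since H is normal, pairing the biminimal equation with H removes the projection: ⟨Δ^φ H, H⟩ = λ|H|²
- ∑ ⟨R^N(H, dφ(e_i)) dφ(e_i), H⟩. As H ⊥ dφ(e_i), each curvature term is ≤ 0, so the whole is ≥ 0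
(`inner_roughLaplacian_nonneg`).

Differentiating ⟨H, dφ(w)⟩ = 0 gives ⟨∇^φ_v H, dφ(w)⟩ = -⟨H, B(v, w)⟩. Hence |∇^φ_(e_i) H|² ≥ ⟨H,
B(e_i, e_i)⟩², and since these m numbers ⟨H, B(e_i, e_i)⟩ add up to m|H|², Cauchy-Schwarz gives |∇^φ
H|² ≥ m|H|⁴ (`le_trace_pullbackDeriv_meanCurvature`).

The analytic burden is the smoothness of H. Its value at y is defined in the chart at y with an
orthonormal basis chosen pointwise, whereas derivatives at x are taken in the chart at x. Chart
independence of B and basis independence of the trace bridge this gap. -/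

namespace RiemGeom

/-! ### Levi-Civita calculus in a coordinate domain -/

section CoordinateLemmas


open Filter Topology

variable {E F G : Type*} [NormedAddCommGroup E] [NormedSpace ℝ E]
  [NormedAddCommGroup F] [NormedSpace ℝ F] [NormedAddCommGroup G] [NormedSpace ℝ G]

/-! Shortcuts that keep instance search for spaces of linear maps away from Riemannian bundles. -/

section Shortcuts

variable {H : Type*} [NormedAddCommGroup H] [NormedSpace ℝ H]

noncomputable instance normedAddCommGroupCLM : NormedAddCommGroup (E →L[ℝ] F) :=
  ContinuousLinearMap.toNormedAddCommGroup

noncomputable instance normedAddCommGroupCLM₂ : NormedAddCommGroup (E →L[ℝ] F →L[ℝ] G) :=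
  ContinuousLinearMap.toNormedAddCommGroup

noncomputable instance normedSpaceCLM₂ : NormedSpace ℝ (E →L[ℝ] F →L[ℝ] G) :=
  ContinuousLinearMap.toNormedSpace

noncomputable instance normedAddCommGroupCLM₃ :
    NormedAddCommGroup (E →L[ℝ] F →L[ℝ] G →L[ℝ] H) :=
  ContinuousLinearMap.toNormedAddCommGroup

noncomputable instance normedSpaceCLM₃ : NormedSpace ℝ (E →L[ℝ] F →L[ℝ] G →L[ℝ] H) :=
  ContinuousLinearMap.toNormedSpace

noncomputable instance normedAddCommGroupCLMDual :
    NormedAddCommGroup ((E →L[ℝ] F) →L[ℝ] G) :=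
  ContinuousLinearMap.toNormedAddCommGroup

noncomputable instance normedSpaceCLMDual : NormedSpace ℝ ((E →L[ℝ] F) →L[ℝ] G) :=
  ContinuousLinearMap.toNormedSpace

end Shortcuts

/-- `g` is a smooth (pseudo-)metric in coordinates around `u`. -/
structure IsMetricAt (g : E → E →L[ℝ] E →L[ℝ] ℝ) (u : E) : Prop where
  contDiffAt : ContDiffAt ℝ ∞ g u
  -- Required near `u`, because symmetry gets differentiated; invertibility is an open condition, so
  -- one point suffices. Positivity plays no role in the coordinate calculus.
  symm : ∀ᶠ u' in 𝓝 u, ∀ v w, g u' v w = g u' w v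
  isInvertible : (g u).IsInvertible

lemma koszulForm_apply (g : E → E →L[ℝ] E →L[ℝ] ℝ) (u v w z : E) :
    koszulForm g u v w z =
      1 / 2 * (fderiv ℝ g u v w z + fderiv ℝ g u w v z - fderiv ℝ g u z v w) := by
  simp [koszulForm]

/-- The Christoffel symbol as a bilinear map. -/
noncomputable def christoffelBilin (g : E → E →L[ℝ] E →L[ℝ] ℝ) (u : E) : E →ₗ[ℝ] E →ₗ[ℝ] E :=
  LinearMap.mk₂ ℝ (christoffel g u)
    (fun v v' w => by
      rw [christoffel, christoffel, christoffel, ← map_add]; congr 1; ext z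
      simp only [koszulForm_apply, add_apply, map_add]; ring)
    (fun c v w => by
      rw [christoffel, christoffel, ← map_smul]; congr 1; ext z
      simp only [koszulForm_apply, smul_apply, map_smul, smul_eq_mul]; ring)
    (fun v w w' => by
      rw [christoffel, christoffel, christoffel, ← map_add]; congr 1; ext z
      simp only [koszulForm_apply, add_apply, map_add]; ring)
    (fun c v w => by
      rw [christoffel, christoffel, ← map_smul]; congr 1; ext z
      simp only [koszulForm_apply, smul_apply, map_smul, smul_eq_mul]; ring)

@[simp] lemma christoffelBilin_apply (g : E → E →L[ℝ] E →L[ℝ] ℝ) (u v w : E) :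
    christoffelBilin g u v w = christoffel g u v w := rfl

/-- Needed for degenerate planes, about which a bound on `sectionalCurvature` says nothing. -/
lemma coordCurvature_zero_right (g : E → E →L[ℝ] E →L[ℝ] ℝ) (u X Y : E) :
    coordCurvature g u X Y 0 = 0 := by
  have h (u' w : E) : christoffel g u' w 0 = 0 := by
    rw [← christoffelBilin_apply, map_zero]
  simp [coordCurvature, h]

variable {g : E → E →L[ℝ] E →L[ℝ] ℝ} {h : F → F →L[ℝ] F →L[ℝ] ℝ} {k : G → G →L[ℝ] G →L[ℝ] ℝ}
  {f : E → F} {u : E}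

lemma IsMetricAt.differentiableAt (hg : IsMetricAt g u) : DifferentiableAt ℝ g u :=
  hg.contDiffAt.differentiableAt (by simp)

lemma IsMetricAt.apply_christoffel (hg : IsMetricAt g u) (v w : E) :
    g u (christoffel g u v w) = koszulForm g u v w :=
  hg.isInvertible.self_apply_inverse _

lemma IsMetricAt.eq_zero (hg : IsMetricAt g u) {a : E} (ha : ∀ z, g u a z = 0) : a = 0 :=
  hg.isInvertible.injective (by ext z; simp [ha])

lemma IsMetricAt.apply_symm (hg : IsMetricAt g u) (v w : E) : g u v w = g u w v :=
  hg.symm.self_of_nhds v w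

lemma fderiv_apply_apply (hg : DifferentiableAt ℝ g u) (z v w : E) :
    fderiv ℝ (fun u' => g u' v w) u z = fderiv ℝ g u z v w := by
  rw [fderiv_clm_apply (hg.clm_apply (differentiableAt_const v)) (differentiableAt_const w),
    fderiv_clm_apply hg (differentiableAt_const v)]
  simp

lemma IsMetricAt.fderiv_symm (hg : IsMetricAt g u) (z v w : E) :
    fderiv ℝ g u z v w = fderiv ℝ g u z w v := by
  rw [← fderiv_apply_apply hg.differentiableAt, ← fderiv_apply_apply hg.differentiableAt]
  have : (fun u' => g u' v w) =ᶠ[𝓝 u] fun u' => g u' w v := hg.symm.mono fun u' h => h v w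
  rw [this.fderiv_eq]

/-- The derivative of `h_f(V, W)`, for metric coefficients `h` along a map `f`. -/
lemma fderiv_metric_comp {V W : E → F} (hh : DifferentiableAt ℝ h (f u))
    (hf : DifferentiableAt ℝ f u) (hV : DifferentiableAt ℝ V u) (hW : DifferentiableAt ℝ W u)
    (z : E) :
    fderiv ℝ (fun u' => h (f u') (V u') (W u')) u z =
      fderiv ℝ h (f u) (fderiv ℝ f u z) (V u) (W u) + h (f u) (fderiv ℝ V u z) (W u)
        + h (f u) (V u) (fderiv ℝ W u z) := by
  have hc : DifferentiableAt ℝ (fun u' => h (f u')) u := hh.comp u hf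
  rw [fderiv_clm_apply (hc.clm_apply hV) hW, fderiv_clm_apply hc hV,
    show (fun u' => h (f u')) = h ∘ f from rfl, fderiv_comp u hh hf]
  simp
  ring

/-- The Levi-Civita connection is metric. -/
lemma fderiv_metric_covAlong {V W : E → F} (hh : IsMetricAt h (f u))
    (hf : DifferentiableAt ℝ f u) (hV : DifferentiableAt ℝ V u) (hW : DifferentiableAt ℝ W u)
    (z : E) :
    fderiv ℝ (fun u' => h (f u') (V u') (W u')) u z =
      h (f u) (covAlong h f V u z) (W u) + h (f u) (V u) (covAlong h f W u z) := by
  rw [fderiv_metric_comp hh.differentiableAt hf hV hW]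
  simp only [covAlong, map_add, add_apply]
  -- In the sum of the two Koszul forms the terms differentiating along `V u` and `W u` cancel,
  -- which leaves the derivative of `h` along `df(z)`.
  rw [hh.apply_symm (V u) (christoffel h (f u) _ _), hh.apply_christoffel, hh.apply_christoffel,
    koszulForm_apply, koszulForm_apply, hh.fderiv_symm (V u) _ (W u), hh.fderiv_symm (W u) _ (V u),
    hh.fderiv_symm _ (W u) (V u)]
  ring

lemma fderiv_fderiv_apply (hf : ContDiffAt ℝ ∞ f u) (v w : E) :
    fderiv ℝ (fun u' => fderiv ℝ f u' w) u v = fderiv ℝ (fderiv ℝ f) u v w := by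
  have h1 : DifferentiableAt ℝ (fderiv ℝ f) u :=
    (hf.fderiv_right (m := 1) (by simpa [one_add_one_eq_two] using ENat.LEInfty.out)).differentiableAt one_ne_zero
  rw [fderiv_clm_apply h1 (differentiableAt_const w)]
  simp

lemma differentiableAt_fderiv (hf : ContDiffAt ℝ ∞ f u) : DifferentiableAt ℝ (fderiv ℝ f) u :=
  (hf.fderiv_right (m := 1) (by simpa [one_add_one_eq_two] using ENat.LEInfty.out)).differentiableAt one_ne_zero

lemma fderiv_fderiv_symm (hf : ContDiffAt ℝ ∞ f u) (v w : E) :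
    fderiv ℝ (fderiv ℝ f) u v w = fderiv ℝ (fderiv ℝ f) u w v :=
  (hf.isSymmSndFDerivAt (by simpa using ENat.LEInfty.out)).eq v w

lemma coordSecondForm_eq (hf : ContDiffAt ℝ ∞ f u) (v w : E) :
    coordSecondForm g h f u v w = fderiv ℝ (fderiv ℝ f) u v w
      + christoffel h (f u) (fderiv ℝ f u v) (fderiv ℝ f u w)
      - fderiv ℝ f u (christoffel g u v w) := by
  rw [coordSecondForm, covAlong, fderiv_fderiv_apply hf]

lemma coordSecondForm_congr {f' : E → F} (hff : f =ᶠ[𝓝 u] f') (v w : E) :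
    coordSecondForm g h f u v w = coordSecondForm g h f' u v w := by
  have h1 : (fun u' => fderiv ℝ f u' w) =ᶠ[𝓝 u] fun u' => fderiv ℝ f' u' w :=
    (hff.fderiv (𝕜 := ℝ)).mono fun u' h => congrArg (· w) h
  rw [coordSecondForm, coordSecondForm, covAlong, covAlong, h1.fderiv_eq, hff.fderiv_eq,
    hff.eq_of_nhds]

/-- The chain rule for the second fundamental form of a composition. -/
lemma coordSecondForm_comp {f₂ : F → G} (hf : ContDiffAt ℝ ∞ f u) (hf₂ : ContDiffAt ℝ ∞ f₂ (f u))
    (v w : E) :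
    coordSecondForm g k (f₂ ∘ f) u v w =
      coordSecondForm h k f₂ (f u) (fderiv ℝ f u v) (fderiv ℝ f u w)
        + fderiv ℝ f₂ (f u) (coordSecondForm g h f u v w) := by
  have hd : DifferentiableAt ℝ f u := hf.differentiableAt (by simp)
  have hd₂ : DifferentiableAt ℝ f₂ (f u) := hf₂.differentiableAt (by simp)
  rw [coordSecondForm_eq (hf₂.comp u hf), coordSecondForm_eq hf, coordSecondForm_eq hf₂,
    fderiv_comp u hd₂ hd]
  have key : fderiv ℝ (fderiv ℝ (f₂ ∘ f)) u v w =
      fderiv ℝ (fderiv ℝ f₂) (f u) (fderiv ℝ f u v) (fderiv ℝ f u w)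
        + fderiv ℝ f₂ (f u) (fderiv ℝ (fderiv ℝ f) u v w) := by
    -- The first-order chain rule is needed on a neighbourhood, since it is about to be
    -- differentiated.
    have h1 : (fun u' => fderiv ℝ (f₂ ∘ f) u') =ᶠ[𝓝 u]
        fun u' => (fderiv ℝ f₂ (f u')).comp (fderiv ℝ f u') := by
      have e1 : ∀ᶠ u' in 𝓝 u, DifferentiableAt ℝ f u' :=
        ((hf.of_le (m := 1) (by exact_mod_cast le_top)).eventually (by simp)).mono
          fun u' h => h.differentiableAt one_ne_zero
      have e2 : ∀ᶠ u' in 𝓝 u, DifferentiableAt ℝ f₂ (f u') :=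
        hd.continuousAt.eventually
          (((hf₂.of_le (m := 1) (by exact_mod_cast le_top)).eventually (by simp)).mono
          fun u' h => h.differentiableAt one_ne_zero)
      filter_upwards [e1, e2] with u' h1 h2
      exact fderiv_comp u' h2 h1
    have hc : DifferentiableAt ℝ (fun u' => fderiv ℝ f₂ (f u')) u :=
      (differentiableAt_fderiv hf₂).comp u hd
    rw [show fderiv ℝ (f₂ ∘ f) = fun u' => fderiv ℝ (f₂ ∘ f) u' from rfl, h1.fderiv_eq,
      fderiv_clm_comp hc (differentiableAt_fderiv hf),
      show (fun u' => fderiv ℝ f₂ (f u')) = fderiv ℝ f₂ ∘ f from rfl,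
      fderiv_comp u (differentiableAt_fderiv hf₂) hd]
    simp [add_comm]
  rw [key]
  -- The Christoffel term of the intermediate metric `h` enters with both signs and cancels, so `h`
  -- is arbitrary here.
  simp only [Function.comp, ContinuousLinearMap.comp_apply, map_add, map_sub]
  abel

/-- The second fundamental form of an isometric immersion is normal. -/
lemma coordSecondForm_normal (hg : IsMetricAt g u) (hh : IsMetricAt h (f u))
    (hf : ContDiffAt ℝ ∞ f u)
    (hiso : ∀ᶠ u' in 𝓝 u, ∀ v w, g u' v w = h (f u') (fderiv ℝ f u' v) (fderiv ℝ f u' w))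
    (v w z : E) :
    h (f u) (coordSecondForm g h f u v w) (fderiv ℝ f u z) = 0 := by
  have hd : DifferentiableAt ℝ f u := hf.differentiableAt (by simp)
  have hdd (a : E) : DifferentiableAt ℝ (fun u' => fderiv ℝ f u' a) u :=
    (differentiableAt_fderiv hf).clm_apply (differentiableAt_const a)
  -- First derivatives of the identity g = f^*h; substituted into the Koszul form of `g`, they
  -- cancel everything because second derivatives of `f` are symmetric.
  have hD (a b c : E) : fderiv ℝ g u a b c =
      fderiv ℝ h (f u) (fderiv ℝ f u a) (fderiv ℝ f u b) (fderiv ℝ f u c)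
        + h (f u) (fderiv ℝ (fderiv ℝ f) u a b) (fderiv ℝ f u c)
        + h (f u) (fderiv ℝ f u b) (fderiv ℝ (fderiv ℝ f) u a c) := by
    rw [← fderiv_apply_apply hg.differentiableAt, ← fderiv_fderiv_apply hf,
      ← fderiv_fderiv_apply hf,
      ← fderiv_metric_comp hh.differentiableAt hd (hdd b) (hdd c)]
    have : (fun u' => g u' b c) =ᶠ[𝓝 u]
        fun u' => h (f u') (fderiv ℝ f u' b) (fderiv ℝ f u' c) := hiso.mono fun u' h => h b c
    rw [this.fderiv_eq]
  rw [coordSecondForm_eq hf]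
  simp only [map_add, map_sub, add_apply, sub_apply]
  rw [← hiso.self_of_nhds, hg.apply_christoffel, hh.apply_christoffel, koszulForm_apply,
    koszulForm_apply, hD, hD, hD, fderiv_fderiv_symm hf w v, fderiv_fderiv_symm hf z v,
    fderiv_fderiv_symm hf w z, hh.apply_symm (fderiv ℝ (fderiv ℝ f) u v z),
    hh.apply_symm (fderiv ℝ f u v) (fderiv ℝ (fderiv ℝ f) u z w)]
  ring

/-- An isometric coordinate change is totally geodesic. -/
lemma coordSecondForm_eq_zero (hg : IsMetricAt g u) (hh : IsMetricAt h (f u))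
    (hf : ContDiffAt ℝ ∞ f u)
    (hiso : ∀ᶠ u' in 𝓝 u, ∀ v w, g u' v w = h (f u') (fderiv ℝ f u' v) (fderiv ℝ f u' w))
    (hsurj : Function.Surjective (fderiv ℝ f u)) (v w : E) :
    coordSecondForm g h f u v w = 0 := by
  refine hh.eq_zero fun z => ?_
  obtain ⟨z, rfl⟩ := hsurj z
  exact coordSecondForm_normal hg hh hf hiso v w z

/-! ### Smoothness of the connection and the Hessian of a squared norm -/

section Smoothness

variable [CompleteSpace E] [CompleteSpace F]

-- Inversion of linear maps is smooth at invertible ones, and the Koszul form is built from first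
-- derivatives of `h`. Base point and arguments all vary, so that both connections along `f` and,
-- with `f = id`, the symbols of `g` are covered.
omit [CompleteSpace E] in
lemma IsMetricAt.contDiffAt_christoffel {V W : E → F} (hh : IsMetricAt h (f u)) {n : ℕ∞}
    (hf : ContDiffAt ℝ n f u) (hV : ContDiffAt ℝ n V u) (hW : ContDiffAt ℝ n W u) :
    ContDiffAt ℝ n (fun u' => christoffel h (f u') (V u') (W u')) u := by
  have hh' : ContDiffAt ℝ n (fun u' => h (f u')) u :=
    (hh.contDiffAt.of_le (by exact_mod_cast le_top)).comp u hf
  have hdh : ContDiffAt ℝ n (fun u' => fderiv ℝ h (f u')) u :=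
    (hh.contDiffAt.fderiv_right (m := n) (by exact_mod_cast le_top)).comp u hf
  have hinv : ContDiffAt ℝ n (fun u' => (h (f u')).inverse) u :=
    ContDiffAt.comp u (g := ContinuousLinearMap.inverse)
      (ContinuousLinearMap.IsInvertible.contDiffAt_map_inverse hh.isInvertible) hh'
  have hflip : ContDiffAt ℝ n (fun u' => (fderiv ℝ h (f u')).flip) u :=
    (ContinuousLinearMap.flipₗᵢ ℝ F F (F →L[ℝ] ℝ)).contDiff.contDiffAt.comp u hdh
  have hflip2 : ContDiffAt ℝ n (fun u' => ((fderiv ℝ h (f u')).flip (V u')).flip) u :=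
    (ContinuousLinearMap.flipₗᵢ ℝ F F ℝ).contDiff.contDiffAt.comp u (hflip.clm_apply hV)
  unfold christoffel koszulForm
  exact hinv.clm_apply (contDiffAt_const.fun_smul
    ((((hdh.clm_apply hV).clm_apply hW).add ((hdh.clm_apply hW).clm_apply hV)).sub
      (hflip2.clm_apply hW)))

omit [CompleteSpace E] in
lemma contDiffAt_covAlong {V : E → F} (hh : IsMetricAt h (f u)) (hf : ContDiffAt ℝ ∞ f u)
    (hV : ContDiffAt ℝ ∞ V u) (w : E) :
    ContDiffAt ℝ ∞ (fun u' => covAlong h f V u' w) u :=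
  ((hV.fderiv_right (m := ∞) (by simp)).clm_apply contDiffAt_const).add
    (hh.contDiffAt_christoffel (n := ⊤) hf
      ((hf.fderiv_right (m := ∞) (by simp)).clm_apply contDiffAt_const) hV)

lemma contDiffAt_coordSecondForm (hg : IsMetricAt g u) (hh : IsMetricAt h (f u))
    (hf : ContDiffAt ℝ ∞ f u) (v w : E) :
    ContDiffAt ℝ ∞ (fun u' => coordSecondForm g h f u' v w) u :=
  (contDiffAt_covAlong hh hf
    ((hf.fderiv_right (m := ∞) (by simp)).clm_apply contDiffAt_const) v).sub
    ((hf.fderiv_right (m := ∞) (by simp)).clm_apply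
      (hg.contDiffAt_christoffel (f := id) (n := ⊤) contDiffAt_id contDiffAt_const
        contDiffAt_const))

omit [CompleteSpace E] in
/-- The Hessian of the squared norm of a vector field along a map. -/
lemma coordHess_metric_self {V : E → F} (hh : ∀ᶠ u' in 𝓝 u, IsMetricAt h (f u'))
    (hf : ContDiffAt ℝ ∞ f u) (hV : ContDiffAt ℝ ∞ V u) (v : E) :
    coordHess g (fun u' => h (f u') (V u') (V u')) u v v =
      2 * h (f u) (coordHessAlong g h f V u v v) (V u)
        + 2 * h (f u) (covAlong h f V u v) (covAlong h f V u v) := by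
  have hh0 := hh.self_of_nhds
  have e1 : ∀ᶠ u' in 𝓝 u, DifferentiableAt ℝ f u' :=
    ((hf.of_le (m := 1) (by exact_mod_cast le_top)).eventually (by simp)).mono
      fun u' h => h.differentiableAt one_ne_zero
  have e2 : ∀ᶠ u' in 𝓝 u, DifferentiableAt ℝ V u' :=
    ((hV.of_le (m := 1) (by exact_mod_cast le_top)).eventually (by simp)).mono
      fun u' h => h.differentiableAt one_ne_zero
  -- Writing the first derivative as a single pairing lets the metric product rule be applied a
  -- second time.
  have h1 (w : E) : (fun u' => fderiv ℝ (fun u' => h (f u') (V u') (V u')) u' w) =ᶠ[𝓝 u]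
      fun u' => h (f u') ((2 : ℝ) • covAlong h f V u' w) (V u') := by
    filter_upwards [hh, e1, e2] with u' a1 a2 a3
    rw [fderiv_metric_covAlong a1 a2 a3 a3, a1.apply_symm (V u')]
    simp [two_mul]
  have hc : DifferentiableAt ℝ (fun u' => covAlong h f V u' v) u :=
    (contDiffAt_covAlong hh0 hf hV v).differentiableAt (by simp)
  rw [coordHess, (h1 v).fderiv_eq, (h1 _).eq_of_nhds,
    fderiv_metric_covAlong hh0 e1.self_of_nhds (hc.fun_const_smul _) e2.self_of_nhds, coordHessAlong]
  have hs : covAlong h f (fun u' => (2 : ℝ) • covAlong h f V u' v) u v =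
      (2 : ℝ) • covAlong h f (fun u' => covAlong h f V u' v) u v := by
    rw [covAlong, fderiv_fun_const_smul hc, ← christoffelBilin_apply, map_smul]
    simp [covAlong]
  rw [hs]
  simp
  ring

end Smoothness

/-- The tangential part of the derivative of a normal field is given by the second fundamental
form. -/
lemma metric_covAlong_fderiv {V : E → F} (hh : IsMetricAt h (f u))
    (hf : ContDiffAt ℝ ∞ f u) (hV : DifferentiableAt ℝ V u)
    (hn : ∀ᶠ u' in 𝓝 u, ∀ w, h (f u') (V u') (fderiv ℝ f u' w) = 0) (v w : E) :
    h (f u) (covAlong h f V u v) (fderiv ℝ f u w) =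
      - h (f u) (V u) (coordSecondForm g h f u v w) := by
  have hz : (fun u' => h (f u') (V u') (fderiv ℝ f u' w)) =ᶠ[𝓝 u] fun _ => 0 :=
    hn.mono fun u' h => h w
  have key := fderiv_metric_covAlong hh (hf.differentiableAt (by simp)) hV
    ((differentiableAt_fderiv hf).clm_apply (differentiableAt_const w)) v
  rw [hz.fderiv_eq] at key
  -- The tangential correction `df(∇_v w)` pairs to zero with the normal field `V`.
  rw [coordSecondForm, map_sub, hn.self_of_nhds]
  simp at key
  linarith

end CoordinateLemmas

/-! ### The metric of a manifold in a chart -/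

section Charts

open Filter Topology

variable {E : Type*} [NormedAddCommGroup E] [NormedSpace ℝ E]
  {M : Type*} [TopologicalSpace M] [ChartedSpace E M] [IsManifold 𝓘(ℝ, E) ∞ M]

lemma toCoord_ofCoord {a z : M} (hz : z ∈ (chartAt E a).source) (v : E) :
    toCoord a z (ofCoord a z v) = v :=
  (trivializationAt E (TangentSpace 𝓘(ℝ, E)) a).continuousLinearMapAt_symmL (R := ℝ)
    (by simpa using hz) v

lemma ofCoord_toCoord {a z : M} (hz : z ∈ (chartAt E a).source) (v : TangentSpace 𝓘(ℝ, E) z) :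
    ofCoord a z (toCoord a z v) = v :=
  (trivializationAt E (TangentSpace 𝓘(ℝ, E)) a).symmL_continuousLinearMapAt (R := ℝ)
    (by simpa using hz) v

omit [IsManifold 𝓘(ℝ, E) ∞ M] in
lemma extChartAt_symm_mem_source {a : M} {u : E} (hu : u ∈ (extChartAt 𝓘(ℝ, E) a).target) :
    (extChartAt 𝓘(ℝ, E) a).symm u ∈ (chartAt E a).source := by
  simpa using (extChartAt 𝓘(ℝ, E) a).map_target hu

omit [IsManifold 𝓘(ℝ, E) ∞ M] in
lemma extChartAt_symm_extChartAt {a z : M} (hz : z ∈ (chartAt E a).source) :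
    (extChartAt 𝓘(ℝ, E) a).symm (extChartAt 𝓘(ℝ, E) a z) = z :=
  (extChartAt 𝓘(ℝ, E) a).left_inv (by simpa using hz)

omit [IsManifold 𝓘(ℝ, E) ∞ M] in
lemma extChartAt_mem_target {a z : M} (hz : z ∈ (chartAt E a).source) :
    extChartAt 𝓘(ℝ, E) a z ∈ (extChartAt 𝓘(ℝ, E) a).target :=
  (extChartAt 𝓘(ℝ, E) a).map_source (by simpa using hz)

omit [IsManifold 𝓘(ℝ, E) ∞ M] in
lemma eventually_mem_extChartAt_target {a : M} {u : E}
    (hu : u ∈ (extChartAt 𝓘(ℝ, E) a).target) :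
    ∀ᶠ u' in 𝓝 u, u' ∈ (extChartAt 𝓘(ℝ, E) a).target :=
  (isOpen_extChartAt_target a).mem_nhds hu

lemma contMDiffAt_extChartAt_symm {a : M} {u : E} (hu : u ∈ (extChartAt 𝓘(ℝ, E) a).target) :
    ContMDiffAt 𝓘(ℝ, E) 𝓘(ℝ, E) ∞ (extChartAt 𝓘(ℝ, E) a).symm u :=
  (contMDiffOn_extChartAt_symm a).contMDiffAt (eventually_mem_extChartAt_target hu)

/-- The section is the inverse trivialization, smooth on its target, applied to the inverse chart
and a constant vector. -/
lemma contMDiffAt_ofCoord {a : M} {u : E} (hu : u ∈ (extChartAt 𝓘(ℝ, E) a).target) (v : E) :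
    ContMDiffAt 𝓘(ℝ, E) (𝓘(ℝ, E).prod 𝓘(ℝ, E)) ∞
      (fun u' => (⟨(extChartAt 𝓘(ℝ, E) a).symm u',
        ofCoord a ((extChartAt 𝓘(ℝ, E) a).symm u') v⟩ :
          TotalSpace E (TangentSpace 𝓘(ℝ, E) : M → Type _))) u := by
  let e := trivializationAt E (TangentSpace 𝓘(ℝ, E) : M → Type _) a
  have h1 : ContMDiffAt 𝓘(ℝ, E) (𝓘(ℝ, E).prod 𝓘(ℝ, E)) ∞
      (fun u' => ((extChartAt 𝓘(ℝ, E) a).symm u', v)) u :=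
    (contMDiffAt_extChartAt_symm hu).prodMk contMDiffAt_const
  have h2 : ContMDiffAt (𝓘(ℝ, E).prod 𝓘(ℝ, E)) (𝓘(ℝ, E).prod 𝓘(ℝ, E)) ∞
      e.toOpenPartialHomeomorph.symm ((extChartAt 𝓘(ℝ, E) a).symm u, v) := by
    refine e.contMDiffOn_symm.contMDiffAt (e.open_target.mem_nhds ?_)
    rw [e.mem_target]
    simpa [e] using extChartAt_symm_mem_source hu
  refine (h2.comp u h1).congr_of_eventuallyEq ?_
  filter_upwards [eventually_mem_extChartAt_target hu] with u' hu'
  have hb : (extChartAt 𝓘(ℝ, E) a).symm u' ∈ e.baseSet := by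
    simpa [e] using extChartAt_symm_mem_source hu'
  rw [Function.comp, ← e.mk_symm hb, ofCoord, e.symmL_apply hb]

variable [RiemannianBundle (fun x : M => TangentSpace 𝓘(ℝ, E) x)]

lemma coordMetric_apply (a : M) (u v w : E) :
    coordMetric a u v w = inner ℝ (ofCoord a ((extChartAt 𝓘(ℝ, E) a).symm u) v)
      (ofCoord a ((extChartAt 𝓘(ℝ, E) a).symm u) w) := rfl

lemma coordMetric_toCoord {a z : M} (hz : z ∈ (chartAt E a).source)
    (v w : TangentSpace 𝓘(ℝ, E) z) :
    coordMetric a (extChartAt 𝓘(ℝ, E) a z) (toCoord a z v) (toCoord a z w) = inner ℝ v w := by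
  rw [coordMetric_apply, extChartAt_symm_extChartAt hz, ofCoord_toCoord hz,
    ofCoord_toCoord hz]

variable [FiniteDimensional ℝ E]
  [IsContMDiffRiemannianBundle 𝓘(ℝ, E) ∞ E (fun x : M => TangentSpace 𝓘(ℝ, E) x)]

/-- In finite dimension smoothness can be tested on entries. Positive definiteness makes v ↦ g(v, ·)
injective, hence bijective onto the dual, which has equal dimension. -/
lemma isMetricAt_coordMetric {a : M} {u : E} (hu : u ∈ (extChartAt 𝓘(ℝ, E) a).target) :
    IsMetricAt (coordMetric a) u where
  contDiffAt := by
    have key (v w : E) : ContDiffOn ℝ ∞ (fun u' => coordMetric a u' v w)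
        (extChartAt 𝓘(ℝ, E) a).target := fun u' hu' =>
      (contMDiffAt_iff_contDiffAt.1 (ContMDiffAt.inner_bundle (IB := 𝓘(ℝ, E)) (F := E)
        (E := fun x : M => TangentSpace 𝓘(ℝ, E) x) (contMDiffAt_ofCoord hu' v)
        (contMDiffAt_ofCoord hu' w))).contDiffWithinAt
    have : ContDiffOn ℝ ∞ (coordMetric a) (extChartAt 𝓘(ℝ, E) a).target :=
      contDiffOn_clm_apply.2 fun v => contDiffOn_clm_apply.2 fun w => key v w
    exact this.contDiffAt (eventually_mem_extChartAt_target hu)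
  symm := Eventually.of_forall fun u' v w => by
    rw [coordMetric_apply, coordMetric_apply, real_inner_comm]
  isInvertible := by
    have hinj : Function.Injective (coordMetric a u).toLinearMap := by
      rw [← LinearMap.ker_eq_bot, LinearMap.ker_eq_bot']
      intro v hv
      have h0 : coordMetric a u v v = 0 := by
        rw [show coordMetric a u v = 0 from hv]; rfl
      rw [coordMetric_apply, inner_self_eq_zero] at h0
      rw [← toCoord_ofCoord (extChartAt_symm_mem_source hu) v, h0, map_zero]
    have hdim : Module.finrank ℝ E = Module.finrank ℝ (E →L[ℝ] ℝ) := by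
      rw [← (LinearMap.toContinuousLinearMap (𝕜 := ℝ) (E := E) (F' := ℝ)).finrank_eq]
      exact (Subspace.dual_finrank_eq).symm
    exact ⟨(LinearEquiv.ofInjectiveOfFinrankEq _ hinj hdim).toContinuousLinearEquiv, by
      ext v w; rfl⟩

end Charts

/-! ### Maps and their differentials in arbitrary charts -/

section MapsInCharts

open Filter Topology

variable {E : Type*} [NormedAddCommGroup E] [NormedSpace ℝ E]
  {M : Type*} [TopologicalSpace M] [ChartedSpace E M] [IsManifold 𝓘(ℝ, E) ∞ M]
  {F : Type*} [NormedAddCommGroup F] [NormedSpace ℝ F]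
  {N : Type*} [TopologicalSpace N] [ChartedSpace F N] [IsManifold 𝓘(ℝ, F) ∞ N]
  {φ : M → N} {a z : M} {b : N} {u : E}

variable (E F) in
/-- The map `φ` in the charts around `a` and `b`. -/
noncomputable def mapInCharts (φ : M → N) (a : M) (b : N) : E → F :=
  extChartAt 𝓘(ℝ, F) b ∘ φ ∘ (extChartAt 𝓘(ℝ, E) a).symm

omit [IsManifold 𝓘(ℝ, E) ∞ M] [IsManifold 𝓘(ℝ, F) ∞ N] in
lemma mapInCharts_extChartAt (hz : z ∈ (chartAt E a).source) :
    mapInCharts E F φ a b (extChartAt 𝓘(ℝ, E) a z) = extChartAt 𝓘(ℝ, F) b (φ z) := by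
  rw [mapInCharts, Function.comp, Function.comp, extChartAt_symm_extChartAt hz]

lemma contDiffAt_mapInCharts (hφ : ContMDiff 𝓘(ℝ, E) 𝓘(ℝ, F) ∞ φ)
    (hu : u ∈ (extChartAt 𝓘(ℝ, E) a).target)
    (hb : φ ((extChartAt 𝓘(ℝ, E) a).symm u) ∈ (chartAt F b).source) :
    ContDiffAt ℝ ∞ (mapInCharts E F φ a b) u :=
  contMDiffAt_iff_contDiffAt.1 ((contMDiffAt_extChartAt' hb).comp u
    (hφ.contMDiffAt.comp u (contMDiffAt_extChartAt_symm hu)))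

omit [NormedSpace ℝ F] [IsManifold 𝓘(ℝ, F) ∞ N] in
lemma eventually_mem_charts (hφ : Continuous φ) (hu : u ∈ (extChartAt 𝓘(ℝ, E) a).target)
    (hb : φ ((extChartAt 𝓘(ℝ, E) a).symm u) ∈ (chartAt F b).source) :
    ∀ᶠ u' in 𝓝 u, u' ∈ (extChartAt 𝓘(ℝ, E) a).target ∧
      φ ((extChartAt 𝓘(ℝ, E) a).symm u') ∈ (chartAt F b).source :=
  (eventually_mem_extChartAt_target hu).and
    ((hφ.continuousAt.comp (contMDiffAt_extChartAt_symm hu).continuousAt).eventually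
      ((chartAt F b).open_source.mem_nhds hb))

/-- The tangent trivializations are the differentials of the charts, so this is the chain rule; it
carries pointwise facts about dφ into coordinates. -/
lemma fderiv_mapInCharts (hφ : ContMDiff 𝓘(ℝ, E) 𝓘(ℝ, F) ∞ φ)
    (hu : u ∈ (extChartAt 𝓘(ℝ, E) a).target)
    (hb : φ ((extChartAt 𝓘(ℝ, E) a).symm u) ∈ (chartAt F b).source) (v : E) :
    fderiv ℝ (mapInCharts E F φ a b) u v =
      toCoord b (φ ((extChartAt 𝓘(ℝ, E) a).symm u))
        (mfderiv 𝓘(ℝ, E) 𝓘(ℝ, F) φ ((extChartAt 𝓘(ℝ, E) a).symm u)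
          (ofCoord a ((extChartAt 𝓘(ℝ, E) a).symm u) v)) := by
  have hs := extChartAt_symm_mem_source hu
  have h1 : MDifferentiableAt 𝓘(ℝ, E) 𝓘(ℝ, E) (extChartAt 𝓘(ℝ, E) a).symm u :=
    (contMDiffAt_extChartAt_symm hu).mdifferentiableAt (by simp)
  have h2 : MDifferentiableAt 𝓘(ℝ, E) 𝓘(ℝ, F) φ ((extChartAt 𝓘(ℝ, E) a).symm u) :=
    hφ.contMDiffAt.mdifferentiableAt (by simp)
  have h3 : MDifferentiableAt 𝓘(ℝ, F) 𝓘(ℝ, F) (extChartAt 𝓘(ℝ, F) b)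
      (φ ((extChartAt 𝓘(ℝ, E) a).symm u)) := mdifferentiableAt_extChartAt hb
  rw [toCoord, TangentBundle.continuousLinearMapAt_trivializationAt hb, ofCoord,
    TangentBundle.symmL_trivializationAt hs, ModelWithCorners.range_eq_univ, mfderivWithin_univ,
    (extChartAt 𝓘(ℝ, E) a).right_inv hu, ← mfderiv_eq_fderiv, mapInCharts,
    mfderiv_comp u h3 (h2.comp u h1), mfderiv_comp u h2 h1]
  rfl

lemma fderiv_mapInCharts_extChartAt (hφ : ContMDiff 𝓘(ℝ, E) 𝓘(ℝ, F) ∞ φ)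
    (hz : z ∈ (chartAt E a).source) (hb : φ z ∈ (chartAt F b).source)
    (v : TangentSpace 𝓘(ℝ, E) z) :
    fderiv ℝ (mapInCharts E F φ a b) (extChartAt 𝓘(ℝ, E) a z) (toCoord a z v) =
      toCoord b (φ z) (mfderiv 𝓘(ℝ, E) 𝓘(ℝ, F) φ z v) := by
  rw [fderiv_mapInCharts hφ (extChartAt_mem_target hz)
    (by rwa [extChartAt_symm_extChartAt hz]), extChartAt_symm_extChartAt hz, ofCoord_toCoord hz]

end MapsInCharts

/-! ### Basis independence of the metric trace -/

section MetricTrace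

variable {E W : Type*} [NormedAddCommGroup E] [NormedSpace ℝ E] [FiniteDimensional ℝ E]
  [AddCommGroup W] [Module ℝ W]

/-- The metric trace of a bilinear map, in terms of an arbitrary basis. -/
lemma sum_orthonormal_eq {ι κ : Type*} [Fintype ι] [Fintype κ] {G : E →L[ℝ] E →L[ℝ] ℝ}
    (hG : G.IsInvertible) (b : Module.Basis κ ℝ E) (ε : ι → E)
    (hε : ∀ w, ∑ i, G w (ε i) • ε i = w) (β : E →ₗ[ℝ] E →ₗ[ℝ] W) :
    ∑ i, β (ε i) (ε i) = ∑ j, ∑ k,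
      b.coord k (G.inverse (LinearMap.toContinuousLinearMap (b.coord j))) • β (b j) (b k) := by
  -- Expanding G⁻¹(b^j) in the `ε i` expresses the inverse metric coefficients through the
  -- coordinates of the frame.
  have coef (j k : κ) : b.coord k (G.inverse (LinearMap.toContinuousLinearMap (b.coord j))) =
      ∑ i, b.coord j (ε i) * b.coord k (ε i) := by
    rw [← hε (G.inverse _), map_sum, hG.self_apply_inverse]
    simp
  have expand (i : ι) : β (ε i) (ε i) =
      ∑ j, ∑ k, (b.coord j (ε i) * b.coord k (ε i)) • β (b j) (b k) := by
    conv_lhs => rw [← b.sum_repr (ε i)]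
    simp only [map_sum, LinearMap.sum_apply, map_smul, LinearMap.smul_apply, Finset.smul_sum,
      smul_smul, Module.Basis.coord_apply]
    rw [Finset.sum_comm]
    simp only [mul_comm]
  simp only [expand, coef, Finset.sum_smul]
  rw [Finset.sum_comm]
  exact Finset.sum_congr rfl fun j _ => Finset.sum_comm

end MetricTrace

/-! ### Bilinearity of the second fundamental form -/

section SecondForm

open Filter Topology

variable {E F : Type*} [NormedAddCommGroup E] [NormedSpace ℝ E]
  [NormedAddCommGroup F] [NormedSpace ℝ F]

/-- The second fundamental form in coordinates, as a bilinear map. -/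
noncomputable def secondFormBilin (g : E → E →L[ℝ] E →L[ℝ] ℝ) (h : F → F →L[ℝ] F →L[ℝ] ℝ)
    (f : E → F) (u : E) : E →ₗ[ℝ] E →ₗ[ℝ] F :=
  LinearMap.mk₂ ℝ (fun v w => fderiv ℝ (fderiv ℝ f) u v w
      + christoffelBilin h (f u) (fderiv ℝ f u v) (fderiv ℝ f u w)
      - fderiv ℝ f u (christoffelBilin g u v w))
    (fun _ _ _ => by simp only [map_add, add_apply, LinearMap.add_apply]; abel)
    (fun _ _ _ => by
      simp only [map_smul, smul_apply, LinearMap.smul_apply, smul_add, smul_sub])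
    (fun _ _ _ => by simp only [map_add]; abel)
    (fun _ _ _ => by simp only [map_smul, smul_add, smul_sub])

lemma secondFormBilin_apply {g : E → E →L[ℝ] E →L[ℝ] ℝ} {h : F → F →L[ℝ] F →L[ℝ] ℝ}
    {f : E → F} {u : E} (hf : ContDiffAt ℝ ∞ f u) (v w : E) :
    secondFormBilin g h f u v w = coordSecondForm g h f u v w :=
  (coordSecondForm_eq hf v w).symm

end SecondForm

/-! ### Chart independence of B; normality and smoothness of H -/

section Immersions

open Filter Topology

variable {E : Type*} [NormedAddCommGroup E] [NormedSpace ℝ E] [FiniteDimensional ℝ E]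
  {M : Type*} [TopologicalSpace M] [ChartedSpace E M] [IsManifold 𝓘(ℝ, E) ∞ M]
  [RiemannianBundle (fun x : M => TangentSpace 𝓘(ℝ, E) x)]
  {F : Type*} [NormedAddCommGroup F] [NormedSpace ℝ F] [FiniteDimensional ℝ F]
  {N : Type*} [TopologicalSpace N] [ChartedSpace F N] [IsManifold 𝓘(ℝ, F) ∞ N]
  [RiemannianBundle (fun y : N => TangentSpace 𝓘(ℝ, F) y)]
  {φ : M → N} {a z : M} {b : N} {u : E}

-- Allows coordinate changes to be treated as isometric immersions read in two charts.
omit [FiniteDimensional ℝ E] [IsManifold 𝓘(ℝ, E) ∞ M] in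
lemma isIsometricImmersion_id : IsIsometricImmersion E E (id : M → M) where
  contMDiff := contMDiff_id
  inner_mfderiv x v w := by rw [mfderiv_id]; rfl

omit [FiniteDimensional ℝ E] [FiniteDimensional ℝ F] in
lemma IsIsometricImmersion.coordMetric_eq (hφ : IsIsometricImmersion E F φ)
    (hu : u ∈ (extChartAt 𝓘(ℝ, E) a).target)
    (hb : φ ((extChartAt 𝓘(ℝ, E) a).symm u) ∈ (chartAt F b).source) (v w : E) :
    coordMetric a u v w = coordMetric b (mapInCharts E F φ a b u)
      (fderiv ℝ (mapInCharts E F φ a b) u v) (fderiv ℝ (mapInCharts E F φ a b) u w) := by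
  rw [fderiv_mapInCharts hφ.contMDiff hu hb, fderiv_mapInCharts hφ.contMDiff hu hb,
    show mapInCharts E F φ a b u =
      extChartAt 𝓘(ℝ, F) b (φ ((extChartAt 𝓘(ℝ, E) a).symm u)) from rfl,
    coordMetric_toCoord hb, hφ.inner_mfderiv, coordMetric_apply]

variable [IsContMDiffRiemannianBundle 𝓘(ℝ, E) ∞ E (fun x : M => TangentSpace 𝓘(ℝ, E) x)]

/-- Coordinate changes have vanishing second fundamental form. -/
lemma coordSecondForm_transition {a b z : M} (ha : z ∈ (chartAt E a).source)
    (hb : z ∈ (chartAt E b).source) (v w : E) :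
    coordSecondForm (coordMetric a) (coordMetric b) (mapInCharts E E (id : M → M) a b)
      (extChartAt 𝓘(ℝ, E) a z) v w = 0 := by
  have hu := extChartAt_mem_target ha
  have hb' : id ((extChartAt 𝓘(ℝ, E) a).symm (extChartAt 𝓘(ℝ, E) a z)) ∈
      (chartAt E b).source := by rwa [extChartAt_symm_extChartAt ha]
  refine coordSecondForm_eq_zero (isMetricAt_coordMetric hu) ?_
    (contDiffAt_mapInCharts contMDiff_id hu hb')
    ((eventually_mem_charts continuous_id hu hb').mono fun u' hu' v w =>
      isIsometricImmersion_id.coordMetric_eq hu'.1 hu'.2 v w) (fun c => ?_) v w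
  · rw [mapInCharts_extChartAt ha]
    exact isMetricAt_coordMetric (extChartAt_mem_target hb)
  · refine ⟨toCoord a z (ofCoord b z c), ?_⟩
    rw [fderiv_mapInCharts_extChartAt (φ := id) contMDiff_id ha hb, mfderiv_id]
    exact toCoord_ofCoord hb c

variable [IsContMDiffRiemannianBundle 𝓘(ℝ, F) ∞ F (fun y : N => TangentSpace 𝓘(ℝ, F) y)]

/-- The second fundamental form may be computed in any charts. -/
lemma IsIsometricImmersion.toCoord_secondFundamentalForm (hφ : IsIsometricImmersion E F φ)
    (hz : z ∈ (chartAt E a).source) (hb : φ z ∈ (chartAt F b).source)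
    (v w : TangentSpace 𝓘(ℝ, E) z) :
    toCoord b (φ z) (secondFundamentalForm E F φ z v w) =
      coordSecondForm (coordMetric a) (coordMetric b) (mapInCharts E F φ a b)
        (extChartAt 𝓘(ℝ, E) a z) (toCoord a z v) (toCoord a z w) := by
  have hzz := mem_chart_source E z
  have hφz := mem_chart_source F (φ z)
  set u := extChartAt 𝓘(ℝ, E) z z with hu_def
  have hu : u ∈ (extChartAt 𝓘(ℝ, E) z).target := extChartAt_mem_target hzz
  have hs : (extChartAt 𝓘(ℝ, E) z).symm u = z := extChartAt_symm_extChartAt hzz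
  set τM := mapInCharts E E (id : M → M) z a with hτM
  set τN := mapInCharts F F (id : N → N) (φ z) b with hτN
  have hτMu : τM u = extChartAt 𝓘(ℝ, E) a z := mapInCharts_extChartAt hzz
  have hfu : mapInCharts E F φ z (φ z) u = extChartAt 𝓘(ℝ, F) (φ z) (φ z) :=
    mapInCharts_extChartAt hzz
  have e1 := eventually_mem_charts (φ := φ) (b := φ z) hφ.contMDiff.continuous hu
    (by rwa [hs])
  have e2 := eventually_mem_charts (φ := (id : M → M)) (b := a) continuous_id hu
    (by rwa [hs])
  -- Both sides are φ read from the chart at `z` to the chart at `b`. Comparing their second forms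
  -- by the chain rule gives the claim, because the transition maps contribute zero.
  have hcomp : τN ∘ mapInCharts E F φ z (φ z) =ᶠ[𝓝 u] mapInCharts E F φ a b ∘ τM := by
    filter_upwards [e1, e2] with u' h1 h2
    simp only [hτM, hτN, mapInCharts, Function.comp]
    rw [extChartAt_symm_extChartAt h1.2, extChartAt_symm_extChartAt h2.2]
    rfl
  have key := coordSecondForm_congr (g := coordMetric z) (h := coordMetric b) hcomp
    (toCoord z z v) (toCoord z z w)
  have cτM : ContDiffAt ℝ ∞ τM u :=
    contDiffAt_mapInCharts contMDiff_id hu (by rwa [hs])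
  have cf : ContDiffAt ℝ ∞ (mapInCharts E F φ z (φ z)) u :=
    contDiffAt_mapInCharts hφ.contMDiff hu (by rwa [hs])
  have cτN : ContDiffAt ℝ ∞ τN (mapInCharts E F φ z (φ z) u) := by
    rw [hfu]
    exact contDiffAt_mapInCharts contMDiff_id (extChartAt_mem_target hφz)
      (by rwa [extChartAt_symm_extChartAt hφz])
  have cfab : ContDiffAt ℝ ∞ (mapInCharts E F φ a b) (τM u) := by
    rw [hτMu]
    exact contDiffAt_mapInCharts hφ.contMDiff (extChartAt_mem_target hz)
      (by rwa [extChartAt_symm_extChartAt hz])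
  have dτM (c : TangentSpace 𝓘(ℝ, E) z) : fderiv ℝ τM u (toCoord z z c) = toCoord a z c := by
    rw [hτM, hu_def, fderiv_mapInCharts_extChartAt (φ := id) contMDiff_id hzz hz, mfderiv_id]
    rfl
  have dτN (c : F) : fderiv ℝ τN (extChartAt 𝓘(ℝ, F) (φ z) (φ z)) c =
      toCoord b (φ z) (ofCoord (φ z) (φ z) c) := by
    conv_lhs => rw [← toCoord_ofCoord hφz c]
    rw [hτN, fderiv_mapInCharts_extChartAt (φ := id) contMDiff_id hφz hb, mfderiv_id]
    rfl
  rw [coordSecondForm_comp (h := coordMetric (φ z)) cf cτN,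
    coordSecondForm_comp (h := coordMetric a) cτM cfab, hfu,
    hu_def, coordSecondForm_transition hzz hz, coordSecondForm_transition hφz hb, map_zero,
    zero_add, add_zero, ← hu_def, dτN, hτMu, dτM, dτM] at key
  exact key

lemma IsIsometricImmersion.inner_secondFundamentalForm_mfderiv
    (hφ : IsIsometricImmersion E F φ) (v w c : TangentSpace 𝓘(ℝ, E) z) :
    inner ℝ (secondFundamentalForm E F φ z v w) (mfderiv 𝓘(ℝ, E) 𝓘(ℝ, F) φ z c) = 0 := by
  have hz := mem_chart_source E z
  have hφz := mem_chart_source F (φ z)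
  have hu := extChartAt_mem_target hz
  have hb : φ ((extChartAt 𝓘(ℝ, E) z).symm (extChartAt 𝓘(ℝ, E) z z)) ∈
      (chartAt F (φ z)).source := by rwa [extChartAt_symm_extChartAt hz]
  rw [← coordMetric_toCoord hφz, hφ.toCoord_secondFundamentalForm hz hφz,
    ← fderiv_mapInCharts_extChartAt hφ.contMDiff hz hφz,
    ← mapInCharts_extChartAt (φ := φ) (b := φ z) hz]
  refine coordSecondForm_normal (isMetricAt_coordMetric hu) ?_
    (contDiffAt_mapInCharts hφ.contMDiff hu hb)
    ((eventually_mem_charts hφ.contMDiff.continuous hu hb).mono fun u' hu' v w =>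
      hφ.coordMetric_eq hu'.1 hu'.2 v w) _ _ _
  rw [mapInCharts_extChartAt hz]
  exact isMetricAt_coordMetric (extChartAt_mem_target hφz)

lemma IsIsometricImmersion.inner_meanCurvature_mfderiv (hφ : IsIsometricImmersion E F φ)
    (c : TangentSpace 𝓘(ℝ, E) z) :
    inner ℝ (meanCurvature E F φ z) (mfderiv 𝓘(ℝ, E) 𝓘(ℝ, F) φ z c) = 0 := by
  rw [meanCurvature, metricTrace, real_inner_smul_left, sum_inner]
  simp [hφ.inner_secondFundamentalForm_mfderiv]

/-- The mean curvature vector field of an isometric immersion is smooth. -/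
lemma IsIsometricImmersion.contDiffAt_coordField_meanCurvature (hφ : IsIsometricImmersion E F φ)
    (x : M) :
    ContDiffAt ℝ ∞ (coordField φ (meanCurvature E F φ) x) (extChartAt 𝓘(ℝ, E) x x) := by
  have hx := mem_chart_source E x
  have hφx := mem_chart_source F (φ x)
  have hu := extChartAt_mem_target hx
  have hb : φ ((extChartAt 𝓘(ℝ, E) x).symm (extChartAt 𝓘(ℝ, E) x x)) ∈
      (chartAt F (φ x)).source := by rwa [extChartAt_symm_extChartAt hx]
  let b := Module.finBasis ℝ E
  set f := mapInCharts E F φ x (φ x) with hf_def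
  have hf : ContDiffAt ℝ ∞ f (extChartAt 𝓘(ℝ, E) x x) :=
    contDiffAt_mapInCharts hφ.contMDiff hu hb
  have hg : IsMetricAt (coordMetric x) (extChartAt 𝓘(ℝ, E) x x) := isMetricAt_coordMetric hu
  have hh : IsMetricAt (coordMetric (φ x)) (f (extChartAt 𝓘(ℝ, E) x x)) := by
    rw [hf_def, mapInCharts_extChartAt hx]
    exact isMetricAt_coordMetric (extChartAt_mem_target hφx)
  -- The pointwise orthonormal bases need not vary continuously. In a fixed basis `b` and the fixed
  -- chart at `x`, the trace becomes an expression in inverse metric coefficients that is visibly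
  -- smooth.
  have hV : coordField φ (meanCurvature E F φ) x =ᶠ[𝓝 (extChartAt 𝓘(ℝ, E) x x)] fun u =>
      (Module.finrank ℝ E : ℝ)⁻¹ • ∑ j, ∑ k, LinearMap.toContinuousLinearMap (b.coord k)
        ((coordMetric x u).inverse (LinearMap.toContinuousLinearMap (b.coord j))) •
          coordSecondForm (coordMetric x) (coordMetric (φ x)) f u (b j) (b k) := by
    filter_upwards [eventually_mem_charts hφ.contMDiff.continuous hu hb] with u ⟨h1, h2⟩
    have hs := extChartAt_symm_mem_source h1
    have hfu : ContDiffAt ℝ ∞ f u := contDiffAt_mapInCharts hφ.contMDiff h1 h2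
    rw [coordField, meanCurvature, metricTrace, map_smul, map_sum]
    simp only [hφ.toCoord_secondFundamentalForm hs h2]
    rw [(extChartAt 𝓘(ℝ, E) x).right_inv h1]
    simp only [← hf_def, ← secondFormBilin_apply hfu]
    congr 1
    refine sum_orthonormal_eq (isMetricAt_coordMetric h1).isInvertible b _ (fun w => ?_) _
    conv_rhs => rw [← toCoord_ofCoord hs w, ← (stdOrthonormalBasis ℝ (TangentSpace 𝓘(ℝ, E)
      ((extChartAt 𝓘(ℝ, E) x).symm u))).sum_repr' (ofCoord x _ w), map_sum]
    refine Finset.sum_congr rfl fun i _ => ?_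
    rw [map_smul, coordMetric_apply, ofCoord_toCoord hs, real_inner_comm]
  refine ContDiffAt.congr_of_eventuallyEq ?_ hV
  refine contDiffAt_const.fun_smul (ContDiffAt.sum fun j _ => ContDiffAt.sum fun k _ => ?_)
  refine ContDiffAt.fun_smul ?_ (contDiffAt_coordSecondForm hg hh hf _ _)
  have hinv : ContDiffAt ℝ ∞ (fun u => (coordMetric x u).inverse) (extChartAt 𝓘(ℝ, E) x x) :=
    ContDiffAt.comp _ (g := ContinuousLinearMap.inverse)
      (ContinuousLinearMap.IsInvertible.contDiffAt_map_inverse hg.isInvertible) hg.contDiffAt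
  exact contDiffAt_const.clm_apply (hinv.clm_apply contDiffAt_const)

end Immersions

/-! ### Bochner formula and the two estimates -/

section Biminimal

open Filter Topology

variable {E : Type*} [NormedAddCommGroup E] [NormedSpace ℝ E] [FiniteDimensional ℝ E]
  {M : Type*} [TopologicalSpace M] [ChartedSpace E M] [IsManifold 𝓘(ℝ, E) ∞ M]
  [RiemannianBundle (fun x : M => TangentSpace 𝓘(ℝ, E) x)]
  {F : Type*} [NormedAddCommGroup F] [NormedSpace ℝ F] [FiniteDimensional ℝ F]
  {N : Type*} [TopologicalSpace N] [ChartedSpace F N] [IsManifold 𝓘(ℝ, F) ∞ N]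
  [RiemannianBundle (fun y : N => TangentSpace 𝓘(ℝ, F) y)]
  {φ : M → N}

variable (E) in
/-- The covariant derivative `∇^φ_v V` at `x` of a vector field `V` along `φ`. -/
noncomputable def pullbackDeriv (φ : M → N) (V : ∀ y : M, TangentSpace 𝓘(ℝ, F) (φ y)) (x : M)
    (v : TangentSpace 𝓘(ℝ, E) x) : TangentSpace 𝓘(ℝ, F) (φ x) :=
  ofCoord (φ x) (φ x) (covAlong (coordMetric (φ x)) (coordMap φ x) (coordField φ V x)
    (extChartAt 𝓘(ℝ, E) x x) (toCoord x x v))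

omit [FiniteDimensional ℝ E] in
lemma coordHess_congr {g : E → E →L[ℝ] E →L[ℝ] ℝ} {a a' : E → ℝ} {u : E} (h : a =ᶠ[𝓝 u] a')
    (v w : E) : coordHess g a u v w = coordHess g a' u v w := by
  have h1 : (fun u' => fderiv ℝ a u' w) =ᶠ[𝓝 u] fun u' => fderiv ℝ a' u' w :=
    (h.fderiv (𝕜 := ℝ)).mono fun u' h => congrArg (· w) h
  rw [coordHess, coordHess, h1.fderiv_eq, h.fderiv_eq]

omit [FiniteDimensional ℝ E] [IsManifold 𝓘(ℝ, E) ∞ M]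
  [RiemannianBundle (fun x : M => TangentSpace 𝓘(ℝ, E) x)] [FiniteDimensional ℝ F] in
/-- The metric of the target in coordinates, evaluated on a vector field along `φ`. -/
lemma coordMetric_coordField (V : ∀ y : M, TangentSpace 𝓘(ℝ, F) (φ y)) {x : M} {u : E}
    (hb : φ ((extChartAt 𝓘(ℝ, E) x).symm u) ∈ (chartAt F (φ x)).source)
    (w : TangentSpace 𝓘(ℝ, F) (φ ((extChartAt 𝓘(ℝ, E) x).symm u))) :
    coordMetric (φ x) (coordMap φ x u) (coordField φ V x u) (toCoord (φ x) _ w) =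
      inner ℝ (V ((extChartAt 𝓘(ℝ, E) x).symm u)) w :=
  coordMetric_toCoord hb _ _

omit [FiniteDimensional ℝ E] [IsManifold 𝓘(ℝ, E) ∞ M]
  [RiemannianBundle (fun x : M => TangentSpace 𝓘(ℝ, E) x)] [FiniteDimensional ℝ F]
  [RiemannianBundle (fun y : N => TangentSpace 𝓘(ℝ, F) y)] in
lemma coordField_extChartAt (V : ∀ y : M, TangentSpace 𝓘(ℝ, F) (φ y)) (x : M) :
    coordField φ V x (extChartAt 𝓘(ℝ, E) x x) = toCoord (φ x) (φ x) (V x) := by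
  rw [coordField, extChartAt_symm_extChartAt (mem_chart_source E x)]

omit [IsManifold 𝓘(ℝ, F) ∞ N] [FiniteDimensional ℝ E] [IsManifold 𝓘(ℝ, E) ∞ M]
  [RiemannianBundle (fun x : M => TangentSpace 𝓘(ℝ, E) x)] [FiniteDimensional ℝ F]
  [RiemannianBundle (fun y : N => TangentSpace 𝓘(ℝ, F) y)] in
lemma coordMap_extChartAt (φ : M → N) (x : M) :
    coordMap φ x (extChartAt 𝓘(ℝ, E) x x) = extChartAt 𝓘(ℝ, F) (φ x) (φ x) :=
  mapInCharts_extChartAt (mem_chart_source E x)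

-- Nonzero orthogonal vectors are independent and make the denominator of the sectional curvature
-- positive; a zero vector makes the expression vanish.
omit [FiniteDimensional ℝ F] in
lemma NonposSectionalCurvature.inner_curvature_nonpos (hN : NonposSectionalCurvature F N)
    {y : N} {X Y : TangentSpace 𝓘(ℝ, F) y} (hXY : inner ℝ X Y = 0) :
    inner ℝ (curvature y X Y Y) X ≤ 0 := by
  rcases eq_or_ne X 0 with hX | hX
  · exact (hX ▸ inner_zero_right _).le
  rcases eq_or_ne Y 0 with rfl | hY
  · have h0 : toCoord y y (0 : TangentSpace 𝓘(ℝ, F) y) = 0 := map_zero _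
    rw [curvature, h0, coordCurvature_zero_right, map_zero, inner_zero_left]
  have hli : LinearIndependent ℝ ![X, Y] := by
    refine linearIndependent_of_ne_zero_of_inner_eq_zero
      (fun i => by fin_cases i <;> simpa) fun i j hij => ?_
    fin_cases i <;> fin_cases j <;> simp_all [real_inner_comm]
  have hs := hN y X Y hli
  have hpos : 0 < ‖X‖ ^ 2 * ‖Y‖ ^ 2 - inner ℝ X Y ^ 2 := by
    rw [hXY]
    have := norm_pos_iff.2 hX
    have := norm_pos_iff.2 hY
    norm_num
    positivity
  rw [sectionalCurvature, div_le_iff₀ hpos, zero_mul] at hs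
  exact hs

variable [IsContMDiffRiemannianBundle 𝓘(ℝ, F) ∞ F (fun y : N => TangentSpace 𝓘(ℝ, F) y)]

/-- The Bochner formula `Δ|V|² = 2 ⟨Δ^φ V, V⟩ + 2 |∇^φ V|²`. -/
lemma laplacian_norm_sq (hφ : ContMDiff 𝓘(ℝ, E) 𝓘(ℝ, F) ∞ φ)
    {V : ∀ y : M, TangentSpace 𝓘(ℝ, F) (φ y)} {x : M}
    (hV : ContDiffAt ℝ ∞ (coordField φ V x) (extChartAt 𝓘(ℝ, E) x x)) :
    laplacian E (fun y => ‖V y‖ ^ 2) x =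
      2 * inner ℝ (roughLaplacian E φ V x) (V x)
        + 2 * metricTrace x fun v w : TangentSpace 𝓘(ℝ, E) x =>
          (inner ℝ (pullbackDeriv E φ V x v) (pullbackDeriv E φ V x w) : ℝ) := by
  have hx := mem_chart_source E x
  have hφx := mem_chart_source F (φ x)
  have hu := extChartAt_mem_target hx
  have hb : φ ((extChartAt 𝓘(ℝ, E) x).symm (extChartAt 𝓘(ℝ, E) x x)) ∈
      (chartAt F (φ x)).source := by rwa [extChartAt_symm_extChartAt hx]
  have hf : ContDiffAt ℝ ∞ (coordMap φ x) (extChartAt 𝓘(ℝ, E) x x) :=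
    contDiffAt_mapInCharts hφ hu hb
  have he := eventually_mem_charts hφ.continuous hu hb
  have hh : ∀ᶠ u in 𝓝 (extChartAt 𝓘(ℝ, E) x x), IsMetricAt (coordMetric (φ x))
      (coordMap φ x u) :=
    he.mono fun u hu' => isMetricAt_coordMetric (extChartAt_mem_target hu'.2)
  have ha : (fun y => ‖V y‖ ^ 2) ∘ (extChartAt 𝓘(ℝ, E) x).symm =ᶠ[𝓝 (extChartAt 𝓘(ℝ, E) x x)]
      fun u => coordMetric (φ x) (coordMap φ x u) (coordField φ V x u) (coordField φ V x u) :=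
    he.mono fun u hu' => by
      rw [Function.comp, ← real_inner_self_eq_norm_sq, ← coordMetric_coordField V hu'.2]
      rfl
  rw [laplacian, metricTrace, roughLaplacian, metricTrace, metricTrace, sum_inner,
    Finset.mul_sum, Finset.mul_sum, ← Finset.sum_add_distrib]
  refine Finset.sum_congr rfl fun i _ => ?_
  rw [coordHess_congr ha, coordHess_metric_self hh hf hV, coordMap_extChartAt,
    coordField_extChartAt, ← coordMetric_toCoord hφx, ← coordMetric_toCoord hφx,
    toCoord_ofCoord hφx, pullbackDeriv, toCoord_ofCoord hφx]

variable [IsContMDiffRiemannianBundle 𝓘(ℝ, E) ∞ E (fun x : M => TangentSpace 𝓘(ℝ, E) x)]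

/-- The tangential part of the derivative of the mean curvature vector field. -/
lemma IsIsometricImmersion.inner_pullbackDeriv_meanCurvature (hφ : IsIsometricImmersion E F φ)
    (x : M) (v w : TangentSpace 𝓘(ℝ, E) x) :
    inner ℝ (pullbackDeriv E φ (meanCurvature E F φ) x v) (mfderiv 𝓘(ℝ, E) 𝓘(ℝ, F) φ x w) =
      - inner ℝ (meanCurvature E F φ x) (secondFundamentalForm E F φ x v w) := by
  have hx := mem_chart_source E x
  have hφx := mem_chart_source F (φ x)
  have hu := extChartAt_mem_target hx
  have hb : φ ((extChartAt 𝓘(ℝ, E) x).symm (extChartAt 𝓘(ℝ, E) x x)) ∈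
      (chartAt F (φ x)).source := by rwa [extChartAt_symm_extChartAt hx]
  have hf : ContDiffAt ℝ ∞ (coordMap φ x) (extChartAt 𝓘(ℝ, E) x x) :=
    contDiffAt_mapInCharts hφ.contMDiff hu hb
  have hh : IsMetricAt (coordMetric (E := F) (φ x)) (coordMap φ x (extChartAt 𝓘(ℝ, E) x x)) := by
    rw [coordMap_extChartAt]
    exact isMetricAt_coordMetric (extChartAt_mem_target hφx)
  have key := metric_covAlong_fderiv (g := coordMetric x) hh hf
    ((hφ.contDiffAt_coordField_meanCurvature x).differentiableAt (by simp))
    ((eventually_mem_charts hφ.contMDiff.continuous hu hb).mono fun u hu' c => by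
      rw [show coordMap φ x = mapInCharts E F φ x (φ x) from rfl,
        fderiv_mapInCharts hφ.contMDiff hu'.1 hu'.2]
      exact (coordMetric_coordField _ hu'.2 _).trans (hφ.inner_meanCurvature_mfderiv _))
    (toCoord x x v) (toCoord x x w)
  rw [coordMap_extChartAt, coordField_extChartAt] at key
  rw [← coordMetric_toCoord hφx, ← coordMetric_toCoord hφx, pullbackDeriv,
    secondFundamentalForm, toCoord_ofCoord hφx, toCoord_ofCoord hφx, ← key,
    ← fderiv_mapInCharts_extChartAt hφ.contMDiff hx hφx]
  rfl

/-- Pairing the equation with the normal field H leaves λ|H|² minus curvature terms that are ≤ 0. -/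
lemma IsBiminimalSubmanifold.inner_roughLaplacian_nonneg (hN : NonposSectionalCurvature F N)
    {lam : ℝ} (hlam : 0 ≤ lam) (hφ : IsBiminimalSubmanifold E F φ lam) (x : M) :
    0 ≤ inner ℝ (roughLaplacian E φ (meanCurvature E F φ) x) (meanCurvature E F φ x) := by
  have hperp (c : TangentSpace 𝓘(ℝ, E) x) :
      inner ℝ (mfderiv 𝓘(ℝ, E) 𝓘(ℝ, F) φ x c) (meanCurvature E F φ x) = 0 := by
    rw [real_inner_comm, hφ.isometric.inner_meanCurvature_mfderiv]
  have hnormal (W : TangentSpace 𝓘(ℝ, F) (φ x)) :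
      inner ℝ (normalPart E φ x W) (meanCurvature E F φ x) =
        inner ℝ W (meanCurvature E F φ x) := by
    obtain ⟨c, hc⟩ := Submodule.starProjection_apply_mem
      (LinearMap.range (mfderiv 𝓘(ℝ, E) 𝓘(ℝ, F) φ x).toLinearMap) W
    rw [normalPart, inner_sub_left, ← hc, sub_eq_self]
    exact hperp c
  have h := congrArg (inner ℝ · (meanCurvature E F φ x)) (hφ.equation x)
  simp only [inner_add_left, hnormal, inner_sub_left, inner_neg_left, real_inner_smul_left,
    inner_zero_left, real_inner_self_eq_norm_sq, metricTrace, sum_inner] at h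
  have hR := Finset.sum_nonpos fun i (_ : i ∈ Finset.univ) =>
    hN.inner_curvature_nonpos (hφ.isometric.inner_meanCurvature_mfderiv (z := x)
      (stdOrthonormalBasis ℝ (TangentSpace 𝓘(ℝ, E) x) i))
  nlinarith [mul_nonneg hlam (sq_nonneg ‖meanCurvature E F φ x‖)]

/-- Of each ∇^φ_(e_i) H only the component along the unit vector dφ(e_i) is kept; these components
are -⟨H, B(e_i, e_i)⟩, whose sum is known. -/
lemma IsIsometricImmersion.le_trace_pullbackDeriv_meanCurvature
    (hφ : IsIsometricImmersion E F φ) (x : M) :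
    Module.finrank ℝ E * ‖meanCurvature E F φ x‖ ^ 4 ≤
      metricTrace x fun v w : TangentSpace 𝓘(ℝ, E) x =>
        (inner ℝ (pullbackDeriv E φ (meanCurvature E F φ) x v)
          (pullbackDeriv E φ (meanCurvature E F φ) x w) : ℝ) := by
  set H := meanCurvature E F φ with hH
  set e := stdOrthonormalBasis ℝ (TangentSpace 𝓘(ℝ, E) x) with he
  let s := fun i => (inner ℝ (H x) (secondFundamentalForm E F φ x (e i) (e i)) : ℝ)
  have h1 : ∑ i, s i ^ 2 ≤ metricTrace x fun v w : TangentSpace 𝓘(ℝ, E) x =>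
        (inner ℝ (pullbackDeriv E φ H x v) (pullbackDeriv E φ H x w) : ℝ) := by
    refine Finset.sum_le_sum fun i _ => ?_
    have hs : s i = - inner ℝ (pullbackDeriv E φ H x (e i))
        (mfderiv 𝓘(ℝ, E) 𝓘(ℝ, F) φ x (e i)) := by
      rw [hφ.inner_pullbackDeriv_meanCurvature, neg_neg]
    have hcs := real_inner_mul_inner_self_le (pullbackDeriv E φ H x (e i))
      (mfderiv 𝓘(ℝ, E) 𝓘(ℝ, F) φ x (e i))
    rw [hφ.inner_mfderiv, real_inner_self_eq_norm_sq (e i), e.norm_eq_one] at hcs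
    rw [hs]
    linarith
  have hcard : Fintype.card (Fin (Module.finrank ℝ (TangentSpace 𝓘(ℝ, E) x))) =
      Module.finrank ℝ E := Fintype.card_fin _
  have h2 : (∑ i, s i) ^ 2 ≤ Module.finrank ℝ E * ∑ i, s i ^ 2 := by
    have := sq_sum_le_card_mul_sum_sq (s := Finset.univ) (f := s)
    rwa [Finset.card_univ, hcard] at this
  -- For m = 0 the factor m cannot be cancelled below, but then the left side is zero.
  rcases Nat.eq_zero_or_pos (Module.finrank ℝ E) with h0 | hpos
  · rw [h0, Nat.cast_zero, zero_mul]
    exact (Finset.sum_nonneg fun i _ => sq_nonneg (s i)).trans h1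
  · have hm : (0 : ℝ) < Module.finrank ℝ E := by exact_mod_cast hpos
    have h3 : ∑ i, s i = Module.finrank ℝ E * ‖H x‖ ^ 2 := by
      rw [← inner_sum, ← real_inner_self_eq_norm_sq, ← real_inner_smul_right]
      congr 1
      rw [hH, meanCurvature, smul_inv_smul₀ hm.ne', metricTrace]
    rw [h3] at h2
    refine le_trans ?_ h1
    -- After multiplication by m, Cauchy-Schwarz reads (m|H|²)² ≤ m ∑ s_i².
    refine le_of_mul_le_mul_left ?_ hm
    calc _ = (Module.finrank ℝ E * ‖H x‖ ^ 2) ^ 2 := by ring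
      _ ≤ _ := h2

/-- For a non-negative biminimal submanifold `φ` of a manifold of non-positive curvature,
`Δ|H|² ≥ 2 m |H|⁴`. -/
lemma IsBiminimalSubmanifold.le_laplacian_norm_sq (hN : NonposSectionalCurvature F N)
    {lam : ℝ} (hlam : 0 ≤ lam) (hφ : IsBiminimalSubmanifold E F φ lam) (x : M) :
    2 * Module.finrank ℝ E * ‖meanCurvature E F φ x‖ ^ 4 ≤
      laplacian E (fun y => ‖meanCurvature E F φ y‖ ^ 2) x := by
  rw [laplacian_norm_sq hφ.isometric.contMDiff
    (hφ.isometric.contDiffAt_coordField_meanCurvature x)]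
  linarith [hφ.inner_roughLaplacian_nonneg hN hlam x,
    hφ.isometric.le_trace_pullbackDeriv_meanCurvature x]

end Biminimal

end RiemGeom

/-! ### Specialization to Euclidean model spaces -/

theorem lemma3p4 {m n : ℕ}
    {M : Type*} [TopologicalSpace M] [ChartedSpace (EuclideanSpace ℝ (Fin m)) M]
    [IsManifold 𝓘(ℝ, EuclideanSpace ℝ (Fin m)) ∞ M]
    [RiemannianBundle (fun x : M => TangentSpace 𝓘(ℝ, EuclideanSpace ℝ (Fin m)) x)]
    [IsContMDiffRiemannianBundle 𝓘(ℝ, EuclideanSpace ℝ (Fin m)) ∞ (EuclideanSpace ℝ (Fin m))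
      (fun x : M => TangentSpace 𝓘(ℝ, EuclideanSpace ℝ (Fin m)) x)]
    {N : Type*} [TopologicalSpace N] [ChartedSpace (EuclideanSpace ℝ (Fin n)) N]
    [IsManifold 𝓘(ℝ, EuclideanSpace ℝ (Fin n)) ∞ N]
    [RiemannianBundle (fun y : N => TangentSpace 𝓘(ℝ, EuclideanSpace ℝ (Fin n)) y)]
    [IsContMDiffRiemannianBundle 𝓘(ℝ, EuclideanSpace ℝ (Fin n)) ∞ (EuclideanSpace ℝ (Fin n))
      (fun y : N => TangentSpace 𝓘(ℝ, EuclideanSpace ℝ (Fin n)) y)]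
    (hN : RiemGeom.NonposSectionalCurvature (EuclideanSpace ℝ (Fin n)) N)
    (φ : M → N) (lam : ℝ) (hlam : 0 ≤ lam)
    (hφ : RiemGeom.IsBiminimalSubmanifold (EuclideanSpace ℝ (Fin m)) (EuclideanSpace ℝ (Fin n))
      φ lam)
    (x : M) :
    RiemGeom.laplacian (EuclideanSpace ℝ (Fin m))
        (fun y => ‖RiemGeom.meanCurvature (EuclideanSpace ℝ (Fin m)) (EuclideanSpace ℝ (Fin n))
          φ y‖ ^ 2) x
      ≥ 2 * (m : ℝ) * ‖RiemGeom.meanCurvature (EuclideanSpace ℝ (Fin m))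
          (EuclideanSpace ℝ (Fin n)) φ x‖ ^ 4 := by
  have h := hφ.le_laplacian_norm_sq hN hlam x
  rwa [finrank_euclideanSpace_fin] at h
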